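/- Definitions. A complete edge-colored graph $G=(V,E_1,\dots,E_k)$ consists of a finite non-empty vertex set $V$ and a map $c$ from the set of all 2-element subsets of $V$ (the edges) to $\{1,\dots,k\}$, which is surjective if $|V|\ge 2$ (if $|V|=1$ there are no edges and no condition is imposed); $E_i$ is the set of edges of color $i$. The $i$-th monochromatic subgraph of $G$ is $(V,E_i)$. For a non-empty $W\subseteq V$, the induced subgraph $G[W]$ is the complete graph on $W$ in which every edge retains its color. A rainbow triangle of $G$ consists of three distinct vertices $u,v,w$ such that the edges $\{u,v\},\{u,w\},\{v,w\}$ have pairwise distinct colors. A surjective map $\delta\colon X\times X\to\{1,\dots,m\}$ on a finite non-empty set $X$ is a symbolic ultrametric if (U1) $\delta(x,y)=\delta(y,x)$ for all $x,y\in X$; (U2) $|\{\delta(x,y),\delta(x,z),\delta(y,z)\}|\le 2$ for all $x,y,z\in X$; and (U3) there are no four distinct elements $x,y,u,v\in X$ with $\delta(x,y)=\delta(y,u)=\delta(u,v)\ne\delta(v,y)=\delta(x,v)=\delta(x,u)$. The graph $G$ is the graph representation of $\delta$ if $V=X$ and $c(\{x,y\})=\delta(x,y)$ for all distinct $x,y\in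 V$. A graph $H$ with vertex set $V$, $|V|=n$, is the simple permutation graph of a permutation $\pi$ of $\{1,\dots,n\}$ if there is a bijection $\ell\colon V\to\{1,\dots,n\}$ such that for all $u,v\in V$ with $\ell(u)>\ell(v)$, $\{u,v\}$ is an edge of $H$ if and only if $\pi^{-1}(\ell(u))<\pi^{-1}(\ell(v))$. The permutation $\pi$ is separable if it has a separating tree: an ordered rooted binary tree whose leaves, read from left to right, are $\pi(1),\dots,\pi(n)$, such that for every vertex of the tree the leaves below it form a set of consecutive integers. Statement. Let $G=(V,E_1,\dots,E_k)$ be a complete edge-colored graph. The following are equivalent: (i) $G$ is the graph representation of a symbolic ultrametric; (ii) $G$ contains no rainbow triangle, and every monochromatic subgraph of $G$ is the simple permutation graph of a separable permutation. Moreover, if $G$ is the graph representation of a symbolic ultrametric, then for every non-empty $W\subseteq V$ and every color $i\in\{1,\dots,k\}$, the $i$-th monochromatic subgraph of $G[W]$ is the simple permutation graph of a separable permutation. -/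

import Mathlib

/-- `δ : X × X → {1, …, k}` (with `Fin k` as set of symbols) is a symbolic ultrametric. -/
structure IsSymbolicUltrametric {X : Type*} {k : ℕ} (δ : X → X → Fin k) : Prop where
  surjective : ∀ i : Fin k, ∃ x y : X, δ x y = i
  symm : ∀ x y : X, δ x y = δ y x
  card_le_two : ∀ x y z : X, ({δ x y, δ x z, δ y z} : Finset (Fin k)).card ≤ 2
  no_path : ¬ ∃ x y u v : X,
    (x ≠ y ∧ x ≠ u ∧ x ≠ v ∧ y ≠ u ∧ y ≠ v ∧ u ≠ v) ∧
    (δ x y = δ y u ∧ δ y u = δ u v) ∧ δ u v ≠ δ v y ∧ (δ v y = δ x v ∧ δ x v = δ x u)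

/-- A coloring `C` of all edges of the complete graph on `V` is a `k`-edge-coloring if every
color occurs. The edgeless graph on a single vertex counts as edge-colored, too. -/
def IsEdgeColoring {V : Type*} {k : ℕ} (C : SimpleGraph.TopEdgeLabeling V (Fin k)) : Prop :=
  Nontrivial V → Function.Surjective C

/-- The complete edge-colored graph given by `C` is the graph representation of `δ`:
the edge `{x, y}` has color `δ(x, y)`. (Color `j + 1` of the set `{1, …, k}` is the element `j`
of `Fin k`, so that colors are compared as numbers.) -/
def IsGraphRepresentation {V : Type*} {k m : ℕ} (C : SimpleGraph.TopEdgeLabeling V (Fin k))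
    (δ : V → V → Fin m) : Prop :=
  ∀ (x y : V) (h : x ≠ y), (C.get x y h : ℕ) = (δ x y : ℕ)

/-- There is a symbolic ultrametric on `V` whose graph representation is given by `C`. -/
def RepresentsSymbolicUltrametric {V : Type*} {k : ℕ}
    (C : SimpleGraph.TopEdgeLabeling V (Fin k)) : Prop :=
  ∃ (m : ℕ) (δ : V → V → Fin m), IsSymbolicUltrametric δ ∧ IsGraphRepresentation C δ

/-- Some three vertices span a triangle whose edges have pairwise distinct colors. -/
def HasRainbowTriangle {V K : Type*} (C : SimpleGraph.TopEdgeLabeling V K) : Prop :=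
  ∃ (u v w : V) (huv : u ≠ v) (huw : u ≠ w) (hvw : v ≠ w),
    C.get u v huv ≠ C.get u w huw ∧ C.get u v huv ≠ C.get v w hvw ∧
      C.get u w huw ≠ C.get v w hvw

/-- The `i`-th monochromatic subgraph: all vertices, and the edges of color `i`. -/
abbrev monochromaticSubgraph {V K : Type*} (C : SimpleGraph.TopEdgeLabeling V K) (i : K) :
    SimpleGraph V :=
  C.labelGraph i

/-- The coloring of the induced subgraph on `W`; every edge retains its color. -/
abbrev inducedColoring {V K : Type*} (C : SimpleGraph.TopEdgeLabeling V K) (W : Set V) :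
    SimpleGraph.TopEdgeLabeling W K :=
  C.pullback (Function.Embedding.subtype (· ∈ W))

/-- `G` is the simple permutation graph of `π` (for some labeling `ℓ` of its vertices): an edge
joins two vertices exactly if the larger label comes before the smaller one in `π`. -/
def IsPermutationGraphOf {V : Type*} {n : ℕ} (G : SimpleGraph V) (π : Equiv.Perm (Fin n)) :
    Prop :=
  ∃ ℓ : V ≃ Fin n, ∀ u v : V, ℓ v < ℓ u → (G.Adj u v ↔ π.symm (ℓ u) < π.symm (ℓ v))

/-- Ordered rooted binary trees with labeled leaves. -/
inductive LeafTree (α : Type*) : Type _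
  | leaf (a : α) : LeafTree α
  | node (l r : LeafTree α) : LeafTree α

/-- The labels of the leaves, from left to right. -/
def LeafTree.leaves {α : Type*} : LeafTree α → List α
  | .leaf a => [a]
  | .node l r => l.leaves ++ r.leaves

/-- Below every vertex of the tree, the labels of the leaves form an interval of values. -/
def LeafTree.IsSeparating {n : ℕ} : LeafTree (Fin n) → Prop
  | .leaf _ => True
  | .node l r => (∃ a b : Fin n, ∀ x : Fin n, x ∈ l.leaves ++ r.leaves ↔ a ≤ x ∧ x ≤ b) ∧
      l.IsSeparating ∧ r.IsSeparating

/-- A permutation is separable if it has a separating tree, that is, an ordered binary tree whose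
leaves are `π(1), …, π(n)` from left to right and in which the leaves below each vertex form an
interval of values. -/
def IsSeparablePermutation {n : ℕ} (π : Equiv.Perm (Fin n)) : Prop :=
  ∃ t : LeafTree (Fin n), t.leaves = List.ofFn π ∧ t.IsSeparating

/-- `G` is the simple permutation graph of a separable permutation. -/
def IsSeparablePermutationGraph {V : Type*} (G : SimpleGraph V) : Prop :=
  ∃ (n : ℕ) (π : Equiv.Perm (Fin n)), IsSeparablePermutation π ∧ IsPermutationGraphOf G π

/-! Both conditions are compared through cographs, the graphs without an induced path P4. Without
rainbow triangles, a violation of (U3) is the same as an induced P4 in some monochromatic subgraph,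
so (i) says: no rainbow triangle, and all monochromatic subgraphs are cographs. It remains that
cographs are the simple permutation graphs of separable permutations. By
`InducedPathFree.splitsIn_or_compl` a cograph decomposes recursively into disjoint unions and joins,
and this decomposition tree is turned into a separating tree. Conversely, each node of a separating
tree places two intervals side by side with all or no edges between them, which creates no induced
P4. Being a cograph is hereditary, which gives the claim on induced subgraphs. -/

/-- No four vertices induce a path `x - y - u - v`; distinctness of the vertices is automatic. -/
def InducedPathFree {V : Type*} (G : SimpleGraph V) : Prop :=
  ∀ x y u v : V, G.Adj x y → G.Adj y u → G.Adj u v →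
    ¬ G.Adj x u → ¬ G.Adj x v → ¬ G.Adj y v → False

/-- P4 is self-complementary: the complement of `x - y - u - v` is `y - v - x - u`. -/
theorem InducedPathFree.compl {V : Type*} {G : SimpleGraph V} (h : InducedPathFree G) :
    InducedPathFree Gᶜ := by
  intro x y u v hxy hyu huv hxu hxv hyv
  have hne : x ≠ u := by rintro rfl; exact hxv huv
  have hne' : x ≠ v := by rintro rfl; exact hyv hxy.symm
  have hne'' : y ≠ v := by rintro rfl; exact hxv hxy
  simp only [SimpleGraph.compl_adj, not_and, not_not] at *
  exact h y v x u (hyv hne'') (hxv hne').symm (hxu hne)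
    (fun e => hxy.2 e.symm) hyu.2 (fun e => huv.2 e.symm)

theorem InducedPathFree.comap {V W : Type*} {G : SimpleGraph V} (h : InducedPathFree G)
    (f : W → V) : InducedPathFree (G.comap f) :=
  fun x y u v => h (f x) (f y) (f u) (f v)

/-! ### Decomposition of cographs -/

/-- `s` is the disjoint union of two non-empty sets between which `G` has no edge. -/
def SplitsIn {V : Type*} [DecidableEq V] (G : SimpleGraph V) (s : Finset V) : Prop :=
  ∃ A B : Finset V, A.Nonempty ∧ B.Nonempty ∧ Disjoint A B ∧ A ∪ B = s ∧
    ∀ a ∈ A, ∀ b ∈ B, ¬ G.Adj a b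

theorem splitsIn_of_forall {V : Type*} [DecidableEq V] {G : SimpleGraph V} {s : Finset V}
    (p : V → Prop) (h₁ : ∃ x ∈ s, p x) (h₂ : ∃ x ∈ s, ¬ p x)
    (h : ∀ a ∈ s, ∀ b ∈ s, p a → ¬ p b → ¬ G.Adj a b) : SplitsIn G s := by
  classical
  refine ⟨s.filter p, s.filter (fun x => ¬ p x), ?_, ?_, Finset.disjoint_filter_filter_not _ _ _,
    Finset.filter_union_filter_not_eq _ _, ?_⟩
  · simpa [Finset.Nonempty] using h₁
  · simpa [Finset.Nonempty] using h₂
  · intro a ha b hb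
    rw [Finset.mem_filter] at ha hb
    exact h a ha.1 b hb.1 ha.2 hb.2

/-- If `v` is adjacent to all of `s`, it is isolated in the complement. Otherwise `v` has a
non-neighbor in one side, say `A`. If `v` has no neighbor in `B`, then `B` splits off. If it has a
neighbor `b` there, the non-neighbors of `v` in `A` split off: an edge from such an `a` to a
neighbor `c ∈ A` of `v` would give the induced path `a - c - v - b`. -/
theorem SplitsIn.insert_or_compl {V : Type*} [DecidableEq V] {G : SimpleGraph V} (hG : InducedPathFree G)
    {s : Finset V} (hs : SplitsIn G s) {v : V} (hv : v ∉ s) :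
    SplitsIn G (insert v s) ∨ SplitsIn Gᶜ (insert v s) := by
  obtain ⟨A, B, hA, hB, hAB, rfl, hcross⟩ := hs
  have key : ∀ A B : Finset V, B.Nonempty → v ∉ A → v ∉ B → Disjoint A B →
      (∀ a ∈ A, ∀ b ∈ B, ¬ G.Adj a b) → (∃ w ∈ A, ¬ G.Adj v w) →
      SplitsIn G (insert v (A ∪ B)) := by
    intro A B hB hvA hvB hAB hcross hw
    by_cases hb : ∃ b ∈ B, G.Adj v b
    · obtain ⟨b, hbB, hvb⟩ := hb
      obtain ⟨w, hwA, hvw⟩ := hw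
      refine splitsIn_of_forall (fun x => x ∈ A ∧ ¬ G.Adj v x) ⟨w, by simp [hwA], hwA, hvw⟩
        ⟨v, by simp, fun h => hvA h.1⟩ ?_
      rintro a - c hc ⟨haA, hva⟩ hc' hac
      rw [Finset.mem_insert, Finset.mem_union] at hc
      rcases hc with rfl | hc | hc
      · exact hva hac.symm
      · have hvc : G.Adj v c := by by_contra h; exact hc' ⟨hc, h⟩
        exact hG a c v b hac hvc.symm hvb (fun h => hva h.symm) (hcross a haA b hbB)
          (hcross c hc b hbB)
      · exact hcross a haA c hc hac
    · obtain ⟨b, hbB⟩ := hB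
      refine splitsIn_of_forall (fun x => x ∈ B) ⟨b, by simp [hbB], hbB⟩ ⟨v, by simp, hvB⟩ ?_
      intro a _ c hc ha hcB hac
      rw [Finset.mem_insert, Finset.mem_union] at hc
      rcases hc with rfl | hc | hc
      · exact hb ⟨a, ha, hac.symm⟩
      · exact hcross c hc a ha hac.symm
      · exact hcB hc
  rw [Finset.mem_union, not_or] at hv
  by_cases h₁ : ∃ w ∈ A, ¬ G.Adj v w
  · exact Or.inl (key A B hB hv.1 hv.2 hAB hcross h₁)
  by_cases h₂ : ∃ w ∈ B, ¬ G.Adj v w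
  · rw [Finset.union_comm]
    exact Or.inl (key B A hA hv.2 hv.1 hAB.symm
      (fun b hb a ha h => hcross a ha b hb h.symm) h₂)
  push Not at h₁ h₂
  obtain ⟨a, ha⟩ := hA
  refine Or.inr (splitsIn_of_forall (fun x => x = v) ⟨v, by simp, rfl⟩
    ⟨a, by simp [ha], by rintro rfl; exact hv.1 ha⟩ ?_)
  rintro _ - c hc rfl hne h
  rw [Finset.mem_insert, Finset.mem_union] at hc
  rcases hc with rfl | hc | hc
  · exact hne rfl
  · exact h.2 (h₁ c hc)
  · exact h.2 (h₂ c hc)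

/-- A graph without induced path on four vertices, or its complement, is disconnected. -/
theorem InducedPathFree.splitsIn_or_compl {V : Type*} [DecidableEq V] {G : SimpleGraph V}
    (hG : InducedPathFree G) (s : Finset V) (hs : s.Nontrivial) :
    SplitsIn G s ∨ SplitsIn Gᶜ s := by
  induction s using Finset.induction with
  | empty => exact absurd hs (by simp)
  | insert v t hv ih =>
    by_cases ht : t.Nontrivial
    · rcases ih ht with h | h
      · exact h.insert_or_compl hG hv
      · simpa [or_comm] using h.insert_or_compl hG.compl hv
    · have htne : t.Nonempty := by
        rw [Finset.nonempty_iff_ne_empty]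
        rintro rfl
        simp at hs
      obtain ⟨w, rfl⟩ := htne.exists_eq_singleton_or_nontrivial.resolve_right ht
      have hvw : v ≠ w := by simpa using hv
      by_cases h : G.Adj v w
      · exact Or.inr ⟨{v}, {w}, by simp, by simp, by simpa using hvw, rfl, by simp [h]⟩
      · exact Or.inl ⟨{v}, {w}, by simp, by simp, by simpa using hvw, rfl, by simp [h]⟩

/-! ### From cographs to separating trees -/

/-- The tree `t` separates the values in `[a, a + |s|)`, `g` matches these values with the
elements of `s`, and the edges of `G` within `s` are the inversions of the list of leaves. -/
structure IsSeparatingTreeFor {V : Type*} {N : ℕ} (G : SimpleGraph V) (s : Finset V) (a : ℕ)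
    (t : LeafTree (Fin N)) (g : Fin N → V) : Prop where
  separating : t.IsSeparating
  nodup : t.leaves.Nodup
  mem_leaves : ∀ i : Fin N, i ∈ t.leaves ↔ a ≤ (i : ℕ) ∧ (i : ℕ) < a + s.card
  bijOn : Set.BijOn g {i | i ∈ t.leaves} s
  pairwise : t.leaves.Pairwise fun i j => G.Adj (g i) (g j) ↔ j < i

/-- The leaves of `l` precede those of `r`. Giving `A` the lower block of values produces no
inversion across (disjoint union); giving it the upper block makes every cross pair an inversion
(join). -/
theorem IsSeparatingTreeFor.node {V : Type*} [DecidableEq V] {N : ℕ} {G : SimpleGraph V}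
    {A B : Finset V} {a b c : ℕ} {l r : LeafTree (Fin N)} {gl gr : Fin N → V}
    (hl : IsSeparatingTreeFor G A a l gl) (hr : IsSeparatingTreeFor G B b r gr)
    (hAB : Disjoint A B) (hA : A.Nonempty) (hN : c + (A ∪ B).card ≤ N)
    (h : (a = c ∧ b = c + A.card ∧ ∀ x ∈ A, ∀ y ∈ B, ¬ G.Adj x y) ∨
      (b = c ∧ a = c + B.card ∧ ∀ x ∈ A, ∀ y ∈ B, G.Adj x y)) :
    ∃ g : Fin N → V, IsSeparatingTreeFor G (A ∪ B) c (.node l r) g := by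
  classical
  have hcard := Finset.card_union_of_disjoint hAB
  have hApos := hA.card_pos
  have hdisj : ∀ i, i ∈ r.leaves → i ∉ l.leaves := by
    intro i hi hi'
    rw [hr.mem_leaves] at hi
    rw [hl.mem_leaves] at hi'
    omega
  have hmem : ∀ i : Fin N, i ∈ l.leaves ++ r.leaves ↔
      c ≤ (i : ℕ) ∧ (i : ℕ) < c + (A ∪ B).card := by
    intro i
    rw [List.mem_append, hl.mem_leaves, hr.mem_leaves]
    omega
  let g : Fin N → V := fun i => if i ∈ l.leaves then gl i else gr i
  have hgl : ∀ i ∈ l.leaves, g i = gl i := fun i hi => if_pos hi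
  have hgr : ∀ i ∈ r.leaves, g i = gr i := fun i hi => if_neg (hdisj i hi)
  have hbl : Set.BijOn g {i | i ∈ l.leaves} A := hl.bijOn.congr fun i hi => (hgl i hi).symm
  have hbr : Set.BijOn g {i | i ∈ r.leaves} B := hr.bijOn.congr fun i hi => (hgr i hi).symm
  -- The interval is closed; its upper end is a valid value because `A` is non-empty.
  refine ⟨g, ⟨⟨⟨⟨c, by omega⟩, ⟨c + (A ∪ B).card - 1, by omega⟩, ?_⟩, hl.separating,
    hr.separating⟩, ?_, hmem, ?_, ?_⟩⟩
  · intro i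
    rw [hmem, Fin.le_def, Fin.le_def]
    dsimp only
    omega
  · exact List.nodup_append'.2 ⟨hl.nodup, hr.nodup, fun i hi hi' => hdisj i hi' hi⟩
  · have hset : {i | i ∈ (LeafTree.node l r).leaves} =
        {i | i ∈ l.leaves} ∪ {i | i ∈ r.leaves} := by
      ext i; simp [LeafTree.leaves]
    rw [hset, Finset.coe_union]
    refine hbl.union hbr ?_
    refine (Set.injOn_union (Set.disjoint_left.2 fun i hi hi' => hdisj i hi' hi)).2 ?_
    refine ⟨hbl.injOn, hbr.injOn, fun i hi j hj hij => ?_⟩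
    exact Finset.disjoint_left.1 hAB (hbl.mapsTo hi) (hij ▸ hbr.mapsTo hj)
  · refine List.pairwise_append.2 ⟨?_, ?_, ?_⟩
    · refine hl.pairwise.imp_of_mem fun {i j} hi hj hij => ?_
      rwa [hgl i hi, hgl j hj]
    · refine hr.pairwise.imp_of_mem fun {i j} hi hj hij => ?_
      rwa [hgr i hi, hgr j hj]
    · intro i hi j hj
      have hiA := hbl.mapsTo hi
      have hjB := hbr.mapsTo hj
      rw [hl.mem_leaves] at hi
      rw [hr.mem_leaves] at hj
      rw [Fin.lt_def]
      rcases h with ⟨_, _, h⟩ | ⟨_, _, h⟩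
      · have := h _ hiA _ hjB
        simp only [this, false_iff]
        omega
      · have := h _ hiA _ hjB
        simp only [this, true_iff]
        omega

theorem InducedPathFree.exists_isSeparatingTreeFor {V : Type*} [DecidableEq V] {N : ℕ}
    {G : SimpleGraph V} (hG : InducedPathFree G) (s : Finset V) (hs : s.Nonempty) :
    ∀ a : ℕ, a + s.card ≤ N →
      ∃ (t : LeafTree (Fin N)) (g : Fin N → V), IsSeparatingTreeFor G s a t g := by
  induction s using Finset.strongInduction with
  | H s ih =>
    intro a ha
    rcases hs.exists_eq_singleton_or_nontrivial with ⟨v, rfl⟩ | hnt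
    · rw [Finset.card_singleton] at ha
      refine ⟨.leaf ⟨a, ha⟩, fun _ => v, trivial, by simp [LeafTree.leaves], ?_, ?_,
        by simp [LeafTree.leaves]⟩
      · intro i
        simp only [LeafTree.leaves, List.mem_singleton, Fin.ext_iff, Finset.card_singleton]
        omega
      · simp [LeafTree.leaves]
    · have key : ∀ A B : Finset V, A.Nonempty → B.Nonempty → Disjoint A B → A ∪ B = s →
          A ⊂ s ∧ B ⊂ s ∧ A.card + B.card = s.card := by
        rintro A B ⟨x, hx⟩ ⟨y, hy⟩ hAB rfl
        refine ⟨?_, ?_, (Finset.card_union_of_disjoint hAB).symm⟩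
        · exact (Finset.ssubset_iff_of_subset Finset.subset_union_left).2
            ⟨y, by simp [hy], Finset.disjoint_right.1 hAB hy⟩
        · exact (Finset.ssubset_iff_of_subset Finset.subset_union_right).2
            ⟨x, by simp [hx], Finset.disjoint_left.1 hAB hx⟩
      rcases hG.splitsIn_or_compl s hnt with ⟨A, B, hA, hB, hAB, hU, hcross⟩ |
        ⟨A, B, hA, hB, hAB, hU, hcross⟩
      · obtain ⟨hAs, hBs, hc⟩ := key A B hA hB hAB hU
        obtain ⟨l, gl, hl⟩ := ih A hAs hA a (by omega)
        obtain ⟨r, gr, hr⟩ := ih B hBs hB (a + A.card) (by omega)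
        obtain ⟨g, hg⟩ := hl.node hr hAB hA (c := a) (by rw [hU]; omega)
          (Or.inl ⟨rfl, rfl, hcross⟩)
        exact ⟨_, g, hU ▸ hg⟩
      · obtain ⟨hAs, hBs, hc⟩ := key A B hA hB hAB hU
        obtain ⟨l, gl, hl⟩ := ih A hAs hA (a + B.card) (by omega)
        obtain ⟨r, gr, hr⟩ := ih B hBs hB a (by omega)
        obtain ⟨g, hg⟩ := hl.node hr hAB hA (c := a) (by rw [hU]; omega)
          (Or.inr ⟨rfl, rfl, fun x hx y hy => by
            have hxy : x ≠ y := fun e => Finset.disjoint_left.1 hAB hx (e ▸ hy)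
            simpa [hxy] using hcross x hx y hy⟩)
        exact ⟨_, g, hU ▸ hg⟩

/-- With offset 0 and `N = |V|` every value is a leaf, so the leaf list is a permutation and `g⁻¹`
labels the vertices. -/
theorem InducedPathFree.isSeparablePermutationGraph {V : Type*} [Finite V] [Nonempty V]
    {G : SimpleGraph V} (hG : InducedPathFree G) : IsSeparablePermutationGraph G := by
  classical
  have := Fintype.ofFinite V
  obtain ⟨t, g, h⟩ := hG.exists_isSeparatingTreeFor (N := Fintype.card V) Finset.univ
    Finset.univ_nonempty 0 (by simp)
  have hmem : ∀ i, i ∈ t.leaves := fun i => (h.mem_leaves i).2 (by simp)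
  have hg : Function.Bijective g := by
    have := h.bijOn
    rwa [show {i | i ∈ t.leaves} = Set.univ from Set.eq_univ_of_forall hmem, Finset.coe_univ,
      Set.bijOn_univ] at this
  have hlen : t.leaves.length = Fintype.card V := by
    have h₁ := List.toFinset_card_of_nodup h.nodup
    rw [← h₁, show t.leaves.toFinset = Finset.univ by ext i; simp [hmem i]]
    simp
  let p : Fin (Fintype.card V) → Fin (Fintype.card V) := fun i => t.leaves.get (i.cast hlen.symm)
  have hp : Function.Injective p := fun i j hij =>
    Fin.cast_injective _ (List.nodup_iff_injective_get.1 h.nodup hij)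
  obtain ⟨π, hπ⟩ : ∃ π : Equiv.Perm (Fin (Fintype.card V)), t.leaves = List.ofFn π := by
    refine ⟨Equiv.ofBijective p (Finite.injective_iff_bijective.1 hp), ?_⟩
    refine List.ext_get (by simp [hlen]) fun n h₁ h₂ => ?_
    simp [p]
  refine ⟨_, π, ⟨t, hπ, h.separating⟩, (Equiv.ofBijective g hg).symm, ?_⟩
  have hpair := h.pairwise
  rw [hπ, List.pairwise_ofFn] at hpair
  intro u v huv
  obtain ⟨i, rfl⟩ := (Equiv.ofBijective g hg).surjective u
  obtain ⟨j, rfl⟩ := (Equiv.ofBijective g hg).surjective v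
  obtain ⟨i, rfl⟩ := π.surjective i
  obtain ⟨j, rfl⟩ := π.surjective j
  simp only [Equiv.symm_apply_apply] at huv ⊢
  rw [Equiv.ofBijective_apply, Equiv.ofBijective_apply]
  rcases lt_trichotomy i j with hij | rfl | hij
  · simp [hpair hij, hij, huv]
  · exact absurd huv (lt_irrefl _)
  · rw [G.adj_comm, hpair hij]
    simp [hij.not_gt, huv.not_gt]

/-! ### From separating trees to cographs -/

theorem LeafTree.IsSeparating.exists_interval {n : ℕ} {t : LeafTree (Fin n)}
    (h : t.IsSeparating) : ∃ a b : Fin n, ∀ x, x ∈ t.leaves ↔ a ≤ x ∧ x ≤ b := by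
  cases t with
  | leaf a => exact ⟨a, a, fun x => by simp [LeafTree.leaves, le_antisymm_iff, and_comm]⟩
  | node l r => exact h.1

/-- P4 and its complement are both connected, so a P4 cannot meet two parts with all or no edges
between them. -/
theorem not_inducedPath_of_forall_adj_iff {V : Type*} {G : SimpleGraph V} {p q : V → Prop}
    {P : Prop} (hpq : ∀ a b, p a → q b → (G.Adj a b ↔ P)) {x y u v : V}
    (hx : p x ∨ q x) (hy : p y ∨ q y) (hu : p u ∨ q u) (hv : p v ∨ q v)
    (hp : ¬ (p x ∧ p y ∧ p u ∧ p v)) (hq : ¬ (q x ∧ q y ∧ q u ∧ q v))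
    (hxy : G.Adj x y) (hyu : G.Adj y u) (huv : G.Adj u v)
    (hxu : ¬ G.Adj x u) (hxv : ¬ G.Adj x v) (hyv : ¬ G.Adj y v) : False := by
  have hpq' : ∀ a b, p a → q b → (G.Adj b a ↔ P) := fun a b ha hb => by
    rw [G.adj_comm, hpq a b ha hb]
  grind

theorem LeafTree.IsSeparating.not_inducedPath {n : ℕ} {t : LeafTree (Fin n)}
    {G : SimpleGraph (Fin n)} (ht : t.IsSeparating) (hnd : t.leaves.Nodup)
    (hpair : t.leaves.Pairwise fun i j => G.Adj i j ↔ j < i) {x y u v : Fin n}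
    (hx : x ∈ t.leaves) (hy : y ∈ t.leaves) (hu : u ∈ t.leaves) (hv : v ∈ t.leaves)
    (hxy : G.Adj x y) (hyu : G.Adj y u) (huv : G.Adj u v)
    (hxu : ¬ G.Adj x u) (hxv : ¬ G.Adj x v) (hyv : ¬ G.Adj y v) : False := by
  induction t with
  | leaf a =>
    simp only [LeafTree.leaves, List.mem_singleton] at hx hy
    exact hxy.ne (hx.trans hy.symm)
  | node l r ihl ihr =>
    obtain ⟨-, hl, hr⟩ := ht
    obtain ⟨hndl, hndr, hdisj⟩ := List.nodup_append'.1 hnd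
    obtain ⟨hpl, hpr, hplr⟩ := List.pairwise_append.1 hpair
    simp only [LeafTree.leaves, List.mem_append] at hx hy hu hv
    obtain ⟨a, b, hab⟩ := hl.exists_interval
    obtain ⟨c, d, hcd⟩ := hr.exists_interval
    -- The leaf values form disjoint intervals `[a, b]` and `[c, d]`, so one lies entirely below the
    -- other.
    have hcross : ∀ i j, i ∈ l.leaves → j ∈ r.leaves → (G.Adj i j ↔ d < a) := by
      intro i j hi hj
      rw [hplr i hi j hj]
      have h₁ := fun h => hdisj ((hab c).2 h)
      have h₂ := fun h => hdisj ((hab d).2 h)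
      have h₃ := fun h h' => hdisj h ((hcd a).2 h')
      have h₄ := fun h h' => hdisj h ((hcd b).2 h')
      rw [hab] at hi
      rw [hcd] at hj
      simp only [hab, hcd] at h₁ h₂ h₃ h₄
      grind
    refine not_inducedPath_of_forall_adj_iff (p := (· ∈ l.leaves)) (q := (· ∈ r.leaves)) hcross
      hx hy hu hv ?_ ?_ hxy hyu huv hxu hxv hyv
    · exact fun ⟨h₁, h₂, h₃, h₄⟩ => ihl hl hndl hpl h₁ h₂ h₃ h₄
    · exact fun ⟨h₁, h₂, h₃, h₄⟩ => ihr hr hndr hpr h₁ h₂ h₃ h₄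

theorem IsSeparablePermutationGraph.inducedPathFree {V : Type*} {G : SimpleGraph V}
    (h : IsSeparablePermutationGraph G) : InducedPathFree G := by
  obtain ⟨n, π, ⟨t, hπ, ht⟩, ℓ, hℓ⟩ := h
  have hnd : t.leaves.Nodup := by
    rw [hπ]
    exact List.nodup_ofFn.2 π.injective
  have hmem : ∀ i, i ∈ t.leaves := fun i => by
    rw [hπ, List.mem_ofFn]
    exact π.surjective i
  have hpair : t.leaves.Pairwise fun i j => (G.comap ℓ.symm).Adj i j ↔ j < i := by
    rw [hπ, List.pairwise_ofFn]
    intro i j hij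
    have hne : π i ≠ π j := π.injective.ne hij.ne
    rw [SimpleGraph.comap_adj]
    rcases lt_or_gt_of_ne hne with h | h
    · rw [G.adj_comm, hℓ _ _ (by simpa using h)]
      simp [hij.not_gt, h.not_gt]
    · rw [hℓ _ _ (by simpa using h)]
      simp [hij, h]
  have hfree : InducedPathFree (G.comap ℓ.symm) := fun x y u v =>
    ht.not_inducedPath hnd hpair (hmem x) (hmem y) (hmem u) (hmem v)
  intro x y u v
  simpa using hfree (ℓ x) (ℓ y) (ℓ u) (ℓ v)

/-! ### Symbolic ultrametrics and colorings -/

theorem monochromaticSubgraph_adj {V K : Type*} {C : SimpleGraph.TopEdgeLabeling V K} {i : K}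
    {x y : V} : (monochromaticSubgraph C i).Adj x y ↔ ∃ h : x ≠ y, C.get x y h = i := by
  simp [monochromaticSubgraph, SimpleGraph.EdgeLabeling.get]

theorem RepresentsSymbolicUltrametric.not_hasRainbowTriangle {V : Type*} {k : ℕ}
    {C : SimpleGraph.TopEdgeLabeling V (Fin k)} (h : RepresentsSymbolicUltrametric C) :
    ¬ HasRainbowTriangle C := by
  obtain ⟨m, δ, hδ, hC⟩ := h
  rintro ⟨u, v, w, huv, huw, hvw, h₁, h₂, h₃⟩
  rw [Ne, Fin.ext_iff] at h₁ h₂ h₃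
  rw [hC, hC, ← Fin.ext_iff] at h₁ h₂ h₃
  have := hδ.card_le_two u v w
  rw [Finset.card_eq_three.2 ⟨_, _, _, h₁, h₂, h₃, rfl⟩] at this
  omega

/-- The triangles `x, u, v` and `x, y, v` each have exactly one edge of color `i`. Not being
rainbow, they force the three non-edges of the path to share one color, contradicting (U3). -/
theorem RepresentsSymbolicUltrametric.inducedPathFree {V : Type*} {k : ℕ}
    {C : SimpleGraph.TopEdgeLabeling V (Fin k)} (h : RepresentsSymbolicUltrametric C)
    (i : Fin k) : InducedPathFree (monochromaticSubgraph C i) := by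
  have hrb := h.not_hasRainbowTriangle
  obtain ⟨m, δ, hδ, hC⟩ := h
  intro x y u v hxy hyu huv hxu hxv hyv
  have nxu : x ≠ u := by rintro rfl; exact hxv huv
  have nxv : x ≠ v := by rintro rfl; exact hyv hxy.symm
  have nyv : y ≠ v := by rintro rfl; exact hxv hxy
  rw [monochromaticSubgraph_adj] at hxy hyu huv
  rw [monochromaticSubgraph_adj, exists_prop_of_true nxu] at hxu
  rw [monochromaticSubgraph_adj, exists_prop_of_true nxv] at hxv
  rw [monochromaticSubgraph_adj, exists_prop_of_true nyv] at hyv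
  obtain ⟨nxy, hxy⟩ := hxy
  obtain ⟨nyu, hyu⟩ := hyu
  obtain ⟨nuv, huv⟩ := huv
  have e₁ : C.get x u nxu = C.get x v nxv := by
    by_contra hne
    exact hrb ⟨x, u, v, nxu, nxv, nuv, hne, by rwa [huv],
      by rwa [huv]⟩
  have e₂ : C.get x v nxv = C.get y v nyv := by
    by_contra hne
    exact hrb ⟨x, y, v, nxy, nxv, nyv, by rw [hxy]; exact Ne.symm hxv,
      by rw [hxy]; exact Ne.symm hyv, hne⟩
  refine hδ.no_path ⟨x, y, u, v, ⟨nxy, nxu, nxv, nyu, nyv, nuv⟩, ?_⟩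
  rw [hδ.symm v y]
  simp only [Fin.ext_iff, ne_eq, ← hC _ _ nxy, ← hC _ _ nxu, ← hC _ _ nxv, ← hC _ _ nyu,
    ← hC _ _ nyv, ← hC _ _ nuv]
  simp only [← Fin.ext_iff]
  exact ⟨⟨hxy.trans hyu.symm, hyu.trans huv.symm⟩, by rw [huv]; exact Ne.symm hyv,
    e₂.symm, e₁.symm⟩

theorem representsSymbolicUltrametric_of_subsingleton {V : Type*} [Nonempty V] [Subsingleton V]
    {k : ℕ} (C : SimpleGraph.TopEdgeLabeling V (Fin k)) : RepresentsSymbolicUltrametric C := by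
  -- On one point a surjective `δ` has exactly one symbol, whatever `k` is.
  refine ⟨1, fun _ _ => 0, ⟨fun i => ?_, fun _ _ => rfl, by simp, ?_⟩,
    fun x y h => absurd (Subsingleton.elim x y) h⟩
  · exact ⟨Classical.arbitrary V, Classical.arbitrary V, Subsingleton.elim _ _⟩
  · rintro ⟨x, y, -, -, ⟨h, -⟩, -⟩
    exact h (Subsingleton.elim x y)

theorem representsSymbolicUltrametric_of_nontrivial {V : Type*} [Nontrivial V]
    {k : ℕ} {C : SimpleGraph.TopEdgeLabeling V (Fin k)} (hC : IsEdgeColoring C)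
    (hrb : ¬ HasRainbowTriangle C)
    (hfree : ∀ i, InducedPathFree (monochromaticSubgraph C i)) :
    RepresentsSymbolicUltrametric C := by
  classical
  obtain ⟨p, q, hpq⟩ := exists_pair_ne V
  -- The diagonal value is arbitrary: the edges already give surjectivity, and (U2) with a repeated
  -- point follows from symmetry.
  let δ : V → V → Fin k := fun x y => if h : x ≠ y then C.get x y h else C.get p q hpq
  have hδ : ∀ x y (h : x ≠ y), δ x y = C.get x y h := fun x y h => dif_pos h
  have hsymm : ∀ x y, δ x y = δ y x := by
    intro x y
    by_cases h : x = y
    · rw [h]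
    · rw [hδ x y h, hδ y x (Ne.symm h)]
      exact C.get_comm ..
  refine ⟨k, δ, ⟨?_, hsymm, ?_, ?_⟩, fun x y h => by rw [hδ x y h]⟩
  · intro i
    obtain ⟨⟨e, he⟩, rfl⟩ := hC inferInstance i
    induction e using Sym2.ind with
    | _ x y =>
      have hxy : x ≠ y := by simpa using he
      exact ⟨x, y, hδ x y hxy⟩
  · intro x y z
    have hcard : ∀ a b c : Fin k, (a = b ∨ a = c ∨ b = c) →
        ({a, b, c} : Finset (Fin k)).card ≤ 2 := by
      rintro a b c (rfl | rfl | rfl)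
      · rw [Finset.insert_eq_of_mem (by simp)]; exact Finset.card_le_two
      · rw [Finset.insert_eq_of_mem (by simp)]; exact Finset.card_le_two
      · rw [Finset.insert_eq_of_mem (a := b) (by simp)]; exact Finset.card_le_two
    apply hcard
    by_cases hxy : x = y
    · exact Or.inr (Or.inr (by rw [hxy]))
    by_cases hxz : x = z
    · exact Or.inr (Or.inl (by rw [← hxz, hsymm]))
    by_cases hyz : y = z
    · exact Or.inl (by rw [hyz])
    by_contra! hne
    rw [hδ _ _ hxy, hδ _ _ hxz, hδ _ _ hyz] at hne
    exact hrb ⟨x, y, z, hxy, hxz, hyz, hne⟩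
  · rintro ⟨x, y, u, v, ⟨nxy, nxu, nxv, nyu, nyv, nuv⟩, ⟨h₁, h₂⟩, h₃, h₄, h₅⟩
    have hadj : ∀ a b (h : a ≠ b), (monochromaticSubgraph C (δ u v)).Adj a b ↔ δ a b = δ u v := by
      intro a b h
      rw [monochromaticSubgraph_adj, exists_prop_of_true h, hδ a b h]
    refine hfree (δ u v) x y u v ((hadj _ _ nxy).2 (h₁.trans h₂)) ((hadj _ _ nyu).2 h₂)
      ((hadj _ _ nuv).2 rfl) ?_ ?_ ?_
    · rw [hadj _ _ nxu]; exact fun e => h₃ ((h₄.trans h₅).trans e).symm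
    · rw [hadj _ _ nxv]; exact fun e => h₃ (h₄.trans e).symm
    · rw [hadj _ _ nyv]; exact fun e => h₃ (by rw [hsymm v y]; exact e.symm)

theorem mainTheorem5 {V : Type*} [Finite V] [Nonempty V] (k : ℕ)
    (G : SimpleGraph.TopEdgeLabeling V (Fin k)) (hG : IsEdgeColoring G) :
    (RepresentsSymbolicUltrametric G ↔
      ¬ HasRainbowTriangle G ∧
        ∀ i : Fin k, IsSeparablePermutationGraph (monochromaticSubgraph G i)) ∧
    (RepresentsSymbolicUltrametric G →
      ∀ W : Set V, W.Nonempty → ∀ i : Fin k,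
        IsSeparablePermutationGraph (monochromaticSubgraph (inducedColoring G W) i)) := by
  refine ⟨⟨fun h => ⟨h.not_hasRainbowTriangle,
    fun i => (h.inducedPathFree i).isSeparablePermutationGraph⟩, ?_⟩, ?_⟩
  · rintro ⟨hrb, hsep⟩
    rcases subsingleton_or_nontrivial V with hV | hV
    · exact representsSymbolicUltrametric_of_subsingleton G
    · exact representsSymbolicUltrametric_of_nontrivial hG hrb fun i => (hsep i).inducedPathFree
  · intro h W hW i
    have := hW.to_subtype
    have heq : monochromaticSubgraph (inducedColoring G W) i =
        (monochromaticSubgraph G i).comap (Subtype.val : W → V) := by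
      ext x y
      rw [SimpleGraph.comap_adj, monochromaticSubgraph_adj, monochromaticSubgraph_adj]
      simp only [ne_eq, Subtype.ext_iff]
      rfl
    rw [heq]
    exact ((h.inducedPathFree i).comap _).isSeparablePermutationGraph
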